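/- Let $\Phi_0$ be an irreducible reduced crystallographic finite root system with simple roots $\mathcal D_0$, Weyl group $W_0$, coroot lattice $\Lambda_0^\vee$ and highest root $\theta$. Let $\mathcal D=\mathcal D_0\cup\{\alpha_0\}$ be the extended (untwisted affine) Dynkin diagram, where $\alpha_0=\delta-\theta$ and $\delta$ is the basic imaginary root, and let $W$ be its Weyl group, generated by the simple reflections $s_\alpha$, $\alpha\in\mathcal D$, acting on the real vector space with basis $\mathcal D$. For $\mathcal K\subset\mathcal D$ let $W_{\mathcal K}$ be the subgroup generated by the $s_\alpha$ with $\alpha\in\mathcal K$; for $w\in W$ let $w^{\mathcal K}$ denote the element of minimal length in the coset $wW_{\mathcal K}$. Identify $W$ with $W_0\ltimes\Lambda_0^\vee$ by the isomorphism given by $s_\alpha\mapsto(s_\alpha,0)$ for $\alpha\in\mathcal D_0$ and $s_{\alpha_0}\mapsto(s_\theta,-\theta^\vee)$, where $(w,q)$ stands for the product $(w,0)(1,q)$, and write $\tau_q$ for the element of $W$ corresponding to $(1,q)$, $q\in\Lambda_0^\vee$ (so that $\tau_q(\delta)=\delta$ and $\tau_q(\alpha)=\alpha-\alpha(q)\delta$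 for $\alpha\in\Phi_0$). Let $\alpha_d\in\mathcal D_0$ be a cominuscule simple root, i.e. one whose coefficient in $\delta$ (equivalently, in $\theta$) is $1$, and let $\varpi_d^\vee$ be the fundamental coweight dual to $\alpha_d$. Put $\mathcal D_d=\mathcal D\setminus\{\alpha_d\}$ and $\mathcal J=\mathcal D_0\setminus\{\alpha_d\}$, and let $w_0$, $w_d$, $w_{\mathcal J}$ be the longest elements of $W_{\mathcal D_0}=W_0$, $W_{\mathcal D_d}$, $W_{\mathcal J}$ respectively. Then $q:=w_0(\varpi_d^\vee)-\varpi_d^\vee$ lies in $\Lambda_0^\vee$, and $$\tau_q=w_0\,w_{\mathcal J}\,w_d\,w_{\mathcal J}=w_0^{\mathcal J}\,w_d^{\mathcal J}.$$ -/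

import Mathlib

open Module

noncomputable section

namespace AffineWeyl

section Words

variable {G I : Type*} [Group G]

/-- The length of `g` with respect to a family `s` of generators that are involutions: the least
number of letters in an expression of `g` as a product of members of the family. -/
def wordLength (s : I → G) (g : G) : ℕ :=
  sInf {n : ℕ | ∃ l : List I, l.length = n ∧ (l.map s).prod = g}

/-- The standard parabolic subgroup generated by the `s i` with `i ∈ K`. -/
def parabolic (s : I → G) (K : Set I) : Subgroup G :=
  Subgroup.closure (s '' K)

/-- `w` is the longest element of the parabolic subgroup attached to `K`. -/
def IsLongest (s : I → G) (K : Set I) (w : G) : Prop :=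
  w ∈ parabolic s K ∧ ∀ u ∈ parabolic s K, wordLength s u ≤ wordLength s w

/-- `u` is the representative of minimal length of the coset `w W_K`. -/
def IsMinRep (s : I → G) (K : Set I) (w u : G) : Prop :=
  w⁻¹ * u ∈ parabolic s K ∧
    ∀ x, w⁻¹ * x ∈ parabolic s K → wordLength s u ≤ wordLength s x

end Words

variable {ι M N : Type*} [AddCommGroup M] [Module ℝ M] [AddCommGroup N] [Module ℝ N]
variable (P : RootPairing ι ℝ M N) (b : P.Base)

/-- `θ` is (the index of) the highest root: its difference with any root is a sum of simple
roots. -/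
def IsHighestRoot {P : RootPairing ι ℝ M N} (b : P.Base) (θ : ι) : Prop :=
  ∀ i, P.root θ - P.root i ∈ AddSubmonoid.closure (P.root '' b.support)

/-! The space `M × ℝ` spanned by the simple roots of the extended diagram: `M` is spanned by the
simple roots of the finite diagram and `(0, 1)` is the basic imaginary root `δ`. The simple roots of
the extended diagram are indexed by `Option b.support`, with `none` for the extra root
`α₀ = δ - θ`. -/

/-- The simple roots of the extended Dynkin diagram. -/
def simpleRoot {P : RootPairing ι ℝ M N} (b : P.Base) (θ : ι) : Option b.support → M × ℝ
  | some i => (P.root i, 0)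
  | none => (-P.root θ, 1)

/-- The simple coroots of the extended Dynkin diagram, as linear forms on `M × ℝ`; they vanish on
`δ`, and the one attached to `α₀` restricts to `-θ^∨` on `M`. -/
def simpleCoroot {P : RootPairing ι ℝ M N} (b : P.Base) (θ : ι) :
    Option b.support → Dual ℝ (M × ℝ)
  | some i => P.coroot' i ∘ₗ LinearMap.fst ℝ M ℝ
  | none => -(P.coroot' θ ∘ₗ LinearMap.fst ℝ M ℝ)

lemma simpleCoroot_simpleRoot {P : RootPairing ι ℝ M N} (b : P.Base) (θ : ι)
    (i : Option b.support) : simpleCoroot b θ i (simpleRoot b θ i) = 2 := by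
  cases i <;> simp [simpleCoroot, simpleRoot]

/-- The simple reflections `v ↦ v - α_i^∨(v) α_i` on `M × ℝ`. -/
def simpleReflection {P : RootPairing ι ℝ M N} (b : P.Base) (θ : ι) (i : Option b.support) :
    (M × ℝ) ≃ₗ[ℝ] (M × ℝ) :=
  Module.reflection (simpleCoroot_simpleRoot b θ i)

/-- The affine Weyl group `W`, i.e. the Weyl group of the extended Dynkin diagram. -/
def affineWeylGroup {P : RootPairing ι ℝ M N} (b : P.Base) (θ : ι) :
    Subgroup ((M × ℝ) ≃ₗ[ℝ] (M × ℝ)) :=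
  Subgroup.closure (Set.range (simpleReflection b θ))

/-- The simple reflections as elements of `W`. -/
def gen {P : RootPairing ι ℝ M N} (b : P.Base) (θ : ι) (i : Option b.support) :
    affineWeylGroup b θ :=
  ⟨simpleReflection b θ i, Subgroup.subset_closure ⟨i, rfl⟩⟩

/-- The (left) action of the finite Weyl group `W₀` on the coweight space `N`, contragredient to its
action on `M`. -/
def coweightAction : P.weylGroup →* (N ≃ₗ[ℝ] N) where
  toFun w := MulOpposite.unop (RootPairing.Equiv.coweightHom P (w⁻¹ : P.weylGroup))
  map_one' := by rw [inv_one, OneMemClass.coe_one, map_one, MulOpposite.unop_one]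
  map_mul' x y := by
    rw [mul_inv_rev, Subgroup.coe_mul, map_mul, MulOpposite.unop_mul]

lemma coweightAction_mem (w : P.weylGroup) {x : N} (hx : x ∈ P.corootSpan ℤ) :
    coweightAction P w x ∈ P.corootSpan ℤ := by
  induction hx using Submodule.span_induction with
  | mem x h =>
    obtain ⟨i, rfl⟩ := h
    refine Submodule.subset_span ⟨_, (RootPairing.Hom.coroot_coweightMap_apply
      P P i ((w⁻¹ : P.weylGroup) : P.Aut).toHom).symm⟩
  | zero => simp
  | add x y _ _ hx hy => rw [map_add]; exact add_mem hx hy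
  | smul a x _ hx => rw [map_zsmul]; exact Submodule.smul_mem _ a hx

/-- The action of the finite Weyl group `W₀` on the coroot lattice `Λ₀^∨`, the latter written
multiplicatively. -/
def corootLatticeAction : P.weylGroup →* MulAut (Multiplicative (P.corootSpan ℤ)) where
  toFun w := AddEquiv.toMultiplicative
    { toFun := fun x ↦ ⟨coweightAction P w x, coweightAction_mem P w x.2⟩
      invFun := fun x ↦ ⟨coweightAction P w⁻¹ x, coweightAction_mem P w⁻¹ x.2⟩
      left_inv := fun x ↦ by ext; simp
      right_inv := fun x ↦ by ext; simp
      map_add' := fun x y ↦ by ext; simp }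
  map_one' := by ext x; simp
  map_mul' x y := by ext z; simp

/-- The semidirect product `W₀ ⋉ Λ₀^∨`. -/
abbrev SemidirectWeyl : Type _ :=
  Multiplicative (P.corootSpan ℤ) ⋊[corootLatticeAction P] P.weylGroup

/-- The element `(1, q)` of `W₀ ⋉ Λ₀^∨`. -/
def latticeElt (q : P.corootSpan ℤ) : SemidirectWeyl P :=
  SemidirectProduct.inl (Multiplicative.ofAdd q)

/-- The standard identification of `W` with `W₀ ⋉ Λ₀^∨`: it sends `s_i` to `(s_i, 0)` for every
simple root `α_i` of the finite diagram, and `s_0` to `(s_θ, -θ^∨)`, where `(w, q)` denotes the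
product of `w ∈ W₀` and `(1, q)`, in this order. As `W` is generated by the `s_i` and `s_0`, there
is at most one such isomorphism. -/
def IsStandardIso {P : RootPairing ι ℝ M N} (b : P.Base) (θ : ι)
    (φ : affineWeylGroup b θ ≃* SemidirectWeyl P) : Prop :=
  (∀ i : b.support,
    φ (gen b θ (some i)) = SemidirectProduct.inr (RootPairing.weylGroup.ofIdx P i)) ∧
  φ (gen b θ none) = SemidirectProduct.inr (RootPairing.weylGroup.ofIdx P θ) *
    latticeElt P (-P.corootSpanMem ℤ θ)

/-- The fundamental coweight `ϖ_d^∨`: the element of `N` dual to the simple root `α_d`. -/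
def fundamentalCoweight {P : RootPairing ι ℝ M N} [P.IsRootSystem] (b : P.Base) (d : b.support) :
    N :=
  P.flip.toLinearMap.toPerfPair.symm (b.toWeightBasis.coord d)

/-- The simple root `α_d` is cominuscule: its coefficient in `δ = α₀ + θ` is one. As `α_d` is a
simple root of the finite diagram, this is its coefficient in the highest root `θ`. -/
def IsCominuscule {P : RootPairing ι ℝ M N} [P.IsRootSystem] (b : P.Base) (θ : ι)
    (d : b.support) : Prop :=
  b.toWeightBasis.repr (P.root θ) d = 1

/-- The simple roots of the finite diagram. -/
def D₀ {P : RootPairing ι ℝ M N} (b : P.Base) : Set (Option b.support) := {none}ᶜ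

/-- The simple roots of the extended diagram other than `α_d`. -/
def Dd {P : RootPairing ι ℝ M N} (b : P.Base) (d : b.support) : Set (Option b.support) :=
  {some d}ᶜ

/-- The simple roots of the finite diagram other than `α_d`. -/
def J {P : RootPairing ι ℝ M N} (b : P.Base) (d : b.support) : Set (Option b.support) :=
  D₀ b ∩ Dd b d

end AffineWeyl

end

open AffineWeyl

namespace AffineWeyl

/-! ### Length and positivity in a geometric representation -/

section Words

variable {G I : Type*} [Group G]

/-! Everything takes place on `M × ℝ`, where translation by any coweight makes sense, not only by
elements of the coroot lattice. Let `T` be translation by `ϖ_d^∨`, in general not an element of `W`.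
Since `q = w₀ϖ_d^∨ - ϖ_d^∨`, `τ_q` is the commutator `w₀ T w₀⁻¹ T⁻¹`.

The key is the operator `x = w_J T`. It fixes no chamber but matches two diagrams: `T` fixes `α_j`
for `j ∈ J` and sends `α_d` to `α_d - δ`, while `w_J` makes the roots of `J` negative and, `α_d`
being cominuscule, exchanges `α_d` and `θ`. So `x α_d = θ - δ = -α₀`, and `x` sends `D₀` to negative
combinations of `D_d`; its inverse does the converse. Thus `x w₀ x⁻¹` lies in `W_{D_d}`
(`conj_mem_parabolic`) and makes every simple root of `D_d` negative, through three sign changes. An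
element of a parabolic subgroup with this property is the longest one, so `x w₀ x⁻¹ = w_d`
(`conj_longest_eq`). As `w₀` and `w_J` are involutions, `w₀ w_J w_d w_J = w₀ T w₀ T⁻¹ = τ_q`.

The facts on lengths follow from the exchange property in `IsGeometricRep`; minimal representatives
are handled by `eq_mul_of_isMinRep`. The isomorphism comes from a faithful action of `W₀ ⋉ Λ₀^∨`
with image `W`. -/

lemma wordLength_le (s : I → G) (l : List I) : wordLength s (l.map s).prod ≤ l.length :=
  Nat.sInf_le ⟨l, rfl, rfl⟩

lemma exists_word_length_eq (s : I → G) {g : G} (h : ∃ l : List I, (l.map s).prod = g) :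
    ∃ l : List I, l.length = wordLength s g ∧ (l.map s).prod = g := by
  obtain ⟨l, hl⟩ := h
  exact Nat.sInf_mem (s := {n : ℕ | ∃ l : List I, l.length = n ∧ (l.map s).prod = g})
    ⟨l.length, l, rfl, hl⟩

lemma prod_reverse_eq_inv {s : I → G} (hs : ∀ i, s i * s i = 1) (l : List I) :
    (l.reverse.map s).prod = (l.map s).prod⁻¹ := by
  induction l with
  | nil => simp
  | cons k t ih =>
    rw [List.reverse_cons, List.map_append, List.prod_append, ih]
    simp [inv_eq_of_mul_eq_one_right (hs k)]

lemma mem_parabolic (s : I → G) {K : Set I} {i : I} (hi : i ∈ K) : s i ∈ parabolic s K :=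
  Subgroup.subset_closure ⟨i, hi, rfl⟩

lemma parabolic_mono (s : I → G) {K L : Set I} (h : K ⊆ L) : parabolic s K ≤ parabolic s L :=
  Subgroup.closure_mono (Set.image_mono h)

lemma exists_word_of_mem_parabolic {s : I → G} (hs : ∀ i, s i * s i = 1) {K : Set I} {g : G}
    (hg : g ∈ parabolic s K) : ∃ l : List I, (∀ i ∈ l, i ∈ K) ∧ (l.map s).prod = g := by
  induction hg using Subgroup.closure_induction with
  | mem x hx =>
    obtain ⟨i, hi, rfl⟩ := hx
    exact ⟨[i], by simpa using hi, by simp⟩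
  | one => exact ⟨[], by simp, by simp⟩
  | mul x y _ _ hx hy =>
    obtain ⟨l, hl, rfl⟩ := hx
    obtain ⟨m, hm, rfl⟩ := hy
    refine ⟨l ++ m, fun i hi ↦ ?_, by simp⟩
    rcases List.mem_append.mp hi with h | h
    exacts [hl i h, hm i h]
  | inv x _ hx =>
    obtain ⟨l, hl, rfl⟩ := hx
    exact ⟨l.reverse, by simpa using hl, prod_reverse_eq_inv hs l⟩

end Words

/-! ### Cones of nonnegative combinations of basis vectors -/

section Cone

variable {I V : Type*} [AddCommGroup V] [Module ℝ V] (B : Basis I ℝ V)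

/-- The vectors with nonnegative coordinates that are supported on `K`. -/
def cone (K : Set I) : AddSubmonoid V where
  carrier := {v | (∀ k, 0 ≤ B.repr v k) ∧ ∀ k ∉ K, B.repr v k = 0}
  zero_mem' := by simp
  add_mem' := by
    rintro v w ⟨hv, hv'⟩ ⟨hw, hw'⟩
    exact ⟨fun k ↦ by simpa using add_nonneg (hv k) (hw k),
      fun k hk ↦ by simp [hv' k hk, hw' k hk]⟩

variable {B}

lemma cone_mono {K L : Set I} (h : K ⊆ L) : cone B K ≤ cone B L :=
  fun _ hv ↦ ⟨hv.1, fun k hk ↦ hv.2 k fun hk' ↦ hk (h hk')⟩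

lemma smul_mem_cone {K : Set I} {v : V} (hv : v ∈ cone B K) {c : ℝ} (hc : 0 ≤ c) :
    c • v ∈ cone B K :=
  ⟨fun k ↦ by simpa using mul_nonneg hc (hv.1 k), fun k hk ↦ by simp [hv.2 k hk]⟩

lemma basis_mem_cone {K : Set I} {i : I} (hi : i ∈ K) : B i ∈ cone B K := by
  classical
  refine ⟨fun k ↦ ?_, fun k hk ↦ ?_⟩
  · rw [B.repr_self_apply]; split_ifs <;> simp
  · rw [B.repr_self_apply, if_neg]; rintro rfl; exact hk hi

lemma map_mem_cone {K L : Set I} (f : V →ₗ[ℝ] V) (hf : ∀ i ∈ K, f (B i) ∈ cone B L) {v : V}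
    (hv : v ∈ cone B K) : f v ∈ cone B L := by
  rw [← B.linearCombination_repr v, Finsupp.linearCombination_apply, Finsupp.sum, map_sum]
  refine sum_mem fun k _ ↦ ?_
  rw [map_smul]
  by_cases hk : k ∈ K
  · exact smul_mem_cone (hf k hk) (hv.1 k)
  · simp [hv.2 k hk]

lemma neg_map_mem_cone {K L : Set I} (f : V →ₗ[ℝ] V) (hf : ∀ i ∈ K, -f (B i) ∈ cone B L) {v : V}
    (hv : v ∈ cone B K) : -f v ∈ cone B L :=
  map_mem_cone (-f) (by simpa using hf) hv

lemma eq_zero_of_mem_cone_of_neg_mem_cone {K L : Set I} {v : V} (hv : v ∈ cone B K)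
    (hv' : -v ∈ cone B L) : v = 0 := by
  refine B.ext_elem fun k ↦ ?_
  have h₁ := hv.1 k
  have h₂ := hv'.1 k
  simp only [map_neg, Finsupp.coe_neg, Pi.neg_apply] at h₂
  simp only [map_zero, Finsupp.coe_zero, Pi.zero_apply]
  linarith

lemma neg_basis_notMem_cone (i : I) : -B i ∉ cone B Set.univ := fun hi ↦
  B.ne_zero i (eq_zero_of_mem_cone_of_neg_mem_cone (basis_mem_cone (Set.mem_univ i)) hi)

end Cone

variable {G I V : Type*} [Group G] [AddCommGroup V] [Module ℝ V]

/-- A group `G` generated by involutions `s i` acts on a space with basis `B` by reflections in the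
basis vectors and permutes a reduced set `R` of roots, each of which has coordinates of one sign. -/
structure IsGeometricRep (s : I → G) (ρ : G →* (V ≃ₗ[ℝ] V)) (B : Basis I ℝ V) (R : Set V) :
    Prop where
  mul_self : ∀ i, s i * s i = 1
  exists_word : ∀ g, ∃ l : List I, (l.map s).prod = g
  basis_mem : ∀ i, B i ∈ R
  map_mem : ∀ g, ∀ v ∈ R, ρ g v ∈ R
  mem_or_neg_mem : ∀ v ∈ R, v ∈ cone B Set.univ ∨ -v ∈ cone B Set.univ
  smul_mem : ∀ i (c : ℝ), c • B i ∈ R → c = 1 ∨ c = -1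
  apply_eq : ∀ i v, ∃ c : ℝ, ρ (s i) v = v + c • B i
  apply_self : ∀ i, ρ (s i) (B i) = -B i
  conj_eq : ∀ g i j, ρ g (B i) = B j → g * s i * g⁻¹ = s j

namespace IsGeometricRep

variable {s : I → G} {ρ : G →* (V ≃ₗ[ℝ] V)} {B : Basis I ℝ V} {R : Set V}

section
variable (h : IsGeometricRep s ρ B R)
include h

/-- `s i` changes only the coordinate at `i`. If the image were negative, all other coordinates of
`v` would vanish, and reducedness would force `v = B i`. -/
lemma apply_mem_cone {v : V} (hv : v ∈ R) (hpos : v ∈ cone B Set.univ) {i : I} (hi : v ≠ B i) :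
    ρ (s i) v ∈ cone B Set.univ := by
  classical
  refine (h.mem_or_neg_mem _ (h.map_mem (s i) v hv)).resolve_right fun hneg ↦ ?_
  obtain ⟨c, hc⟩ := h.apply_eq i v
  rw [hc] at hneg
  have h0 : ∀ k, k ≠ i → B.repr v k = 0 := fun k hk ↦ by
    have h₁ := hneg.1 k
    simp only [map_neg, map_add, map_smul, Finsupp.coe_neg, Finsupp.coe_add, Finsupp.coe_smul,
      Pi.neg_apply, Pi.add_apply, Pi.smul_apply, B.repr_self_apply, if_neg hk.symm] at h₁
    have h₂ := hpos.1 k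
    simp only [smul_zero, add_zero] at h₁
    linarith
  have hv' : v = (B.repr v i) • B i := by
    refine B.ext_elem fun k ↦ ?_
    by_cases hk : k = i
    · subst hk; simp
    · simp [h0 k hk, Ne.symm hk]
  rcases h.smul_mem i _ (hv' ▸ hv) with h1 | h1
  · exact hi (by rw [hv', h1, one_smul])
  · have := hpos.1 i
    linarith

/-- Follow `B i` through the word from the right. At the letter `k` where its image turns negative,
that image was `B k`, so conjugation turns `s i` into `s k` and the letter `k` can be deleted. -/
lemma exchange {i : I} (l : List I) (hl : -ρ (l.map s).prod (B i) ∈ cone B Set.univ) :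
    ∃ l' : List I, l'.Sublist l ∧ l'.length + 1 = l.length ∧
      (l'.map s).prod = (l.map s).prod * s i := by
  induction l with
  | nil => exact absurd (by simpa using hl) (neg_basis_notMem_cone i)
  | cons k t ih =>
    have hv := h.map_mem (t.map s).prod _ (h.basis_mem i)
    rcases h.mem_or_neg_mem _ hv with hpos | hneg
    · have hk : ρ (t.map s).prod (B i) = B k := by
        by_contra hne
        have h1 := h.apply_mem_cone hv hpos hne
        have h2 : ρ (s k) (ρ (t.map s).prod (B i)) = 0 :=
          eq_zero_of_mem_cone_of_neg_mem_cone h1 (by simpa using hl)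
        exact B.ne_zero i (by simpa using h2)
      have := h.conj_eq _ _ _ hk
      refine ⟨t, List.sublist_cons_self k t, rfl, ?_⟩
      rw [List.map_cons, List.prod_cons, mul_assoc, mul_inv_eq_iff_eq_mul.mp this, ← mul_assoc,
        h.mul_self, one_mul]
    · obtain ⟨l', hsub, hlen, hprod⟩ := ih hneg
      refine ⟨k :: l', hsub.cons_cons k, by simp [hlen], ?_⟩
      simp [hprod, mul_assoc]

lemma wordLength_mul_lt {g : G} {i : I} (hg : -ρ g (B i) ∈ cone B Set.univ) :
    wordLength s (g * s i) < wordLength s g := by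
  obtain ⟨l, hl, rfl⟩ := exists_word_length_eq s (h.exists_word g)
  obtain ⟨l', -, hlen, hprod⟩ := h.exchange l hg
  have := wordLength_le s l'
  rw [hprod] at this
  omega

lemma lt_wordLength_mul {g : G} {i : I} (hg : ρ g (B i) ∈ cone B Set.univ) :
    wordLength s g < wordLength s (g * s i) := by
  have := h.wordLength_mul_lt (g := g * s i) (i := i) (by simpa [h.apply_self] using hg)
  rwa [mul_assoc, h.mul_self, mul_one] at this

lemma wordLength_inv_le (g : G) : wordLength s g⁻¹ ≤ wordLength s g := by
  obtain ⟨l, hl, rfl⟩ := exists_word_length_eq s (h.exists_word g)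
  rw [← prod_reverse_eq_inv h.mul_self, ← hl, ← List.length_reverse]
  exact wordLength_le s _

lemma isLongest_inv {K : Set I} {w : G} (hw : IsLongest s K w) : IsLongest s K w⁻¹ := by
  refine ⟨inv_mem hw.1, fun u hu ↦ (hw.2 u hu).trans ?_⟩
  simpa using h.wordLength_inv_le w⁻¹

/-- If the word ends in `k` and keeps `B k` positive, the word without `k` makes `B k` negative, so
exchange yields a shorter word for the same element, still with letters in `K`. -/
lemma prod_eq_one {K : Set I} (n : ℕ) (l : List I) (hn : l.length = n) (hl : ∀ i ∈ l, i ∈ K)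
    (hpos : ∀ i ∈ K, ρ (l.map s).prod (B i) ∈ cone B Set.univ) : (l.map s).prod = 1 := by
  induction n using Nat.strong_induction_on generalizing l with
  | _ n ih =>
    rcases List.eq_nil_or_concat' l with rfl | ⟨t, k, rfl⟩
    · simp
    · have hk := hpos k (hl k (by simp))
      obtain ⟨t', hsub, hlen, hprod⟩ := h.exchange (i := k) t (by simpa [h.apply_self] using hk)
      have heq : ((t ++ [k]).map s).prod = (t'.map s).prod := by simp [hprod]
      rw [heq]
      rw [heq] at hpos
      refine ih t'.length ?_ t' rfl (fun i hi ↦ hl i ?_) hpos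
      · rw [← hn, List.length_append, List.length_singleton]; omega
      · exact List.mem_append_left _ (hsub.subset hi)

lemma eq_one_of_mem_parabolic {K : Set I} {g : G} (hg : g ∈ parabolic s K)
    (hpos : ∀ i ∈ K, ρ g (B i) ∈ cone B Set.univ) : g = 1 := by
  obtain ⟨l, hl, rfl⟩ := exists_word_of_mem_parabolic h.mul_self hg
  exact h.prod_eq_one l.length l rfl hl hpos

/-- Elements of a parabolic subgroup change only the coordinates in the corresponding set. -/
lemma repr_apply_of_mem_parabolic {K : Set I} {g : G} (hg : g ∈ parabolic s K) (v : V) {k : I}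
    (hk : k ∉ K) : B.repr (ρ g v) k = B.repr v k := by
  classical
  induction hg using Subgroup.closure_induction generalizing v with
  | mem x hx =>
    obtain ⟨i, hi, rfl⟩ := hx
    obtain ⟨c, hc⟩ := h.apply_eq i v
    have hik : i ≠ k := by rintro rfl; exact hk hi
    simp [hc, hik]
  | one => simp
  | mul x y _ _ hx hy => simp only [map_mul, LinearEquiv.mul_apply, hx, hy]
  | inv x _ hx =>
    have := hx (ρ x⁻¹ v)
    rw [← LinearEquiv.mul_apply, ← map_mul] at this
    simpa using this.symm

lemma apply_basis_mem_or_neg_mem {K : Set I} {g : G} (hg : g ∈ parabolic s K) {i : I}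
    (hi : i ∈ K) : ρ g (B i) ∈ cone B K ∨ -ρ g (B i) ∈ cone B K := by
  classical
  have hz : ∀ k ∉ K, B.repr (ρ g (B i)) k = 0 := fun k hk ↦ by
    have hik : i ≠ k := by rintro rfl; exact hk hi
    rw [h.repr_apply_of_mem_parabolic hg _ hk, B.repr_self_apply, if_neg hik]
  refine (h.mem_or_neg_mem _ (h.map_mem g _ (h.basis_mem i))).imp (fun hp ↦ ⟨hp.1, hz⟩)
    fun hp ↦ ⟨hp.1, fun k hk ↦ by simp [hz k hk]⟩

lemma neg_apply_mem_of_isLongest {K : Set I} {w : G} (hw : IsLongest s K w) {i : I} (hi : i ∈ K) :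
    -ρ w (B i) ∈ cone B K := by
  refine (h.apply_basis_mem_or_neg_mem hw.1 hi).resolve_left fun hpos ↦ ?_
  have h1 := h.lt_wordLength_mul (cone_mono (Set.subset_univ K) hpos)
  have h2 := hw.2 _ (mul_mem hw.1 (mem_parabolic s hi))
  omega

/-- Both `v` and `w⁻¹` make the simple roots of `K` negative, so `w⁻¹ * v` keeps them positive and
is trivial. -/
lemma eq_of_isLongest {K : Set I} {w v : G} (hw : IsLongest s K w) (hv : v ∈ parabolic s K)
    (hneg : ∀ i ∈ K, -ρ v (B i) ∈ cone B K) : v = w := by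
  have hinv := h.isLongest_inv hw
  refine (inv_mul_eq_one.mp (h.eq_one_of_mem_parabolic (mul_mem hinv.1 hv) fun i hi ↦ ?_)).symm
  have := neg_map_mem_cone (ρ w⁻¹).toLinearMap
    (fun j hj ↦ h.neg_apply_mem_of_isLongest hinv hj) (hneg i hi)
  rw [map_mul, LinearEquiv.mul_apply]
  exact cone_mono (Set.subset_univ K) (by simpa using this)

lemma inv_eq_self_of_isLongest {K : Set I} {w : G} (hw : IsLongest s K w) : w⁻¹ = w :=
  have hinv := h.isLongest_inv hw
  h.eq_of_isLongest hw hinv.1 fun _ hi ↦ h.neg_apply_mem_of_isLongest hinv hi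

lemma apply_apply_of_isLongest {K : Set I} {w : G} (hw : IsLongest s K w) (v : V) :
    ρ w (ρ w v) = v := by
  rw [← LinearEquiv.mul_apply, ← map_mul,
    mul_eq_one_iff_inv_eq.mpr (h.inv_eq_self_of_isLongest hw), map_one, LinearEquiv.coe_one, id]

/-- It suffices that `w⁻¹ * x` makes each simple root of `J` negative. If it kept `B i` positive,
applying `w` would show that `x` makes `B i` negative, and `x * s i` would be a shorter element of
the coset. -/
lemma eq_mul_of_isMinRep {J K : Set I} (hJK : J ⊆ K) {w u x : G} (hw : IsLongest s K w)
    (hu : IsLongest s J u) (hx : IsMinRep s J w x) : x = w * u := by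
  rw [← inv_mul_eq_iff_eq_mul]
  refine h.eq_of_isLongest hu hx.1 fun i hi ↦
    (h.apply_basis_mem_or_neg_mem hx.1 hi).resolve_left fun hpos ↦ ?_
  have h1 := neg_map_mem_cone (ρ w).toLinearMap
    (fun j hj ↦ h.neg_apply_mem_of_isLongest hw hj) (cone_mono hJK hpos)
  have h2 : -ρ x (B i) ∈ cone B K := by
    rw [LinearEquiv.coe_coe, ← LinearEquiv.mul_apply, ← map_mul, mul_inv_cancel_left] at h1
    exact h1
  have h3 := h.wordLength_mul_lt (cone_mono (Set.subset_univ K) h2)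
  have h4 := hx.2 (x * s i) (by rw [← mul_assoc]; exact mul_mem hx.1 (mem_parabolic s hi))
  omega

end

end IsGeometricRep

noncomputable section

open RootPairing

variable {ι M N : Type*} [AddCommGroup M] [Module ℝ M] [AddCommGroup N] [Module ℝ N]

/-! ### Translations, the finite Weyl group and affine reflections acting on `M × ℝ` -/

section Action

variable (P : RootPairing ι ℝ M N)

lemma toLinearMap_coweightAction (w : P.weylGroup) (m : M) (n : N) :
    P.toLinearMap m (coweightAction P w n) = P.toLinearMap (w⁻¹ • m) n :=
  (LinearMap.congr_fun
    (Hom.weight_coweight_transpose_apply P P n (w⁻¹ : P.weylGroup).1.toHom) m).symm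

lemma toLinearMap_smul_coweightAction (w : P.weylGroup) (m : M) (n : N) :
    P.toLinearMap (w • m) (coweightAction P w n) = P.toLinearMap m n := by
  rw [toLinearMap_coweightAction, inv_smul_smul]

lemma coweightAction_coroot (w : P.weylGroup) (i : ι) :
    coweightAction P w (P.coroot i) = P.coroot (P.weylGroupToPerm w i) :=
  RootPairing.Hom.coroot_coweightMap_apply P P i ((w⁻¹ : P.weylGroup) : P.Aut).toHom

lemma ofIdx_inv (i : ι) : (weylGroup.ofIdx P i)⁻¹ = weylGroup.ofIdx P i :=
  Subtype.ext (Equiv.reflection_inv P i)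

lemma coweightAction_ofIdx (i : ι) (n : N) :
    coweightAction P (weylGroup.ofIdx P i) n = P.coreflection i n := by
  have : coweightAction P (weylGroup.ofIdx P i)⁻¹ n = P.coreflection i n := by
    change RootPairing.Equiv.coweightEquiv P P ((weylGroup.ofIdx P i)⁻¹⁻¹ : P.weylGroup).1 n = _
    rw [inv_inv]
    rfl
  rwa [ofIdx_inv] at this

/-- The finite Weyl group acting on `M × ℝ`, trivially on the second factor. -/
def finiteHom : P.weylGroup →* ((M × ℝ) ≃ₗ[ℝ] (M × ℝ)) where
  toFun w := (RootPairing.Equiv.weightHom P w).prodCongr (LinearEquiv.refl ℝ ℝ)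
  map_one' := by ext <;> simp
  map_mul' x y := by ext <;> simp

@[simp] lemma finiteHom_apply (w : P.weylGroup) (v : M × ℝ) :
    finiteHom P w v = (w • v.1, v.2) := rfl

/-- The translation by a coweight `q`, acting on `M × ℝ`. -/
def translation (q : N) : (M × ℝ) ≃ₗ[ℝ] (M × ℝ) where
  toFun v := (v.1, v.2 - P.toLinearMap v.1 q)
  invFun v := (v.1, v.2 + P.toLinearMap v.1 q)
  map_add' v w := by ext <;> simp; ring
  map_smul' c v := by ext <;> simp; ring
  left_inv v := by simp
  right_inv v := by simp

@[simp] lemma translation_apply (q : N) (v : M × ℝ) :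
    translation P q v = (v.1, v.2 - P.toLinearMap v.1 q) := rfl

lemma translation_add (q r : N) : translation P (q + r) = translation P q * translation P r := by
  apply LinearEquiv.ext
  intro v
  simp only [LinearEquiv.mul_apply, translation_apply, map_add]
  ext <;> simp; ring

lemma translation_zero : translation P 0 = 1 := by
  apply LinearEquiv.ext
  intro v
  simp

lemma translation_neg (q : N) : translation P (-q) = (translation P q)⁻¹ := by
  rw [eq_inv_iff_mul_eq_one, ← translation_add, neg_add_cancel, translation_zero]

/-- Translations by elements of the coroot lattice. -/
def latticeHom : Multiplicative (P.corootSpan ℤ) →* ((M × ℝ) ≃ₗ[ℝ] (M × ℝ)) where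
  toFun q := translation P (q.toAdd : N)
  map_one' := translation_zero P
  map_mul' _ _ := translation_add P _ _

/-- Valid for every coweight: it gives the semidirect product relation and is later applied to
`ϖ_d^∨`. -/
lemma finiteHom_conj_translation (w : P.weylGroup) (q : N) :
    finiteHom P w * translation P q * (finiteHom P w)⁻¹ =
      translation P (coweightAction P w q) := by
  rw [mul_inv_eq_iff_eq_mul]
  apply LinearEquiv.ext
  intro v
  simp [toLinearMap_smul_coweightAction]

/-- The action of `W₀ ⋉ Λ₀^∨` on `M × ℝ`. -/
def semidirectHom : SemidirectWeyl P →* ((M × ℝ) ≃ₗ[ℝ] (M × ℝ)) :=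
  SemidirectProduct.lift (latticeHom P) (finiteHom P) fun w ↦ by
    refine MonoidHom.ext fun q ↦ ?_
    exact (finiteHom_conj_translation P w _).symm

@[simp] lemma semidirectHom_inr (w : P.weylGroup) :
    semidirectHom P (SemidirectProduct.inr w) = finiteHom P w :=
  SemidirectProduct.lift_inr ..

@[simp] lemma semidirectHom_latticeElt (q : P.corootSpan ℤ) :
    semidirectHom P (latticeElt P q) = translation P q :=
  SemidirectProduct.lift_inl ..

lemma semidirectHom_apply (x : SemidirectWeyl P) :
    semidirectHom P x = translation P (x.left.toAdd : N) * finiteHom P x.right := rfl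

lemma semidirectHom_injective : Function.Injective (semidirectHom P) := by
  rw [injective_iff_map_eq_one]
  intro x hx
  rw [semidirectHom_apply] at hx
  have hr : x.right = 1 := by
    refine Subtype.ext (Equiv.weightHom_injective P ?_)
    ext m
    exact congrArg Prod.fst (LinearEquiv.congr_fun hx (m, 0))
  rw [hr, map_one, mul_one] at hx
  have hl : ((x.left.toAdd : P.corootSpan ℤ) : N) = 0 := by
    refine P.flip.toPerfPair.injective ?_
    ext m
    have := congrArg Prod.snd (LinearEquiv.congr_fun hx (m, 0))
    simpa using this
  refine SemidirectProduct.ext ?_ hr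
  exact Multiplicative.toAdd.injective (Subtype.ext hl)

/-- The reflection of `M × ℝ` in the affine root `α_j + r δ`. -/
def affineReflection (j : ι) (r : ℝ) : (M × ℝ) ≃ₗ[ℝ] (M × ℝ) :=
  Module.reflection (x := (P.root j, r)) (f := P.coroot' j ∘ₗ LinearMap.fst ℝ M ℝ) (by simp)

lemma affineReflection_apply (j : ι) (r : ℝ) (v : M × ℝ) :
    affineReflection P j r v = v - P.toLinearMap v.1 (P.coroot j) • (P.root j, r) := rfl

lemma smul_root (w : P.weylGroup) (i : ι) : w • P.root i = P.root (P.weylGroupToPerm w i) :=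
  P.weylGroup_apply_root w i

lemma finiteHom_conj_affineReflection (w : P.weylGroup) (j : ι) (r : ℝ) :
    finiteHom P w * affineReflection P j r * (finiteHom P w)⁻¹ =
      affineReflection P (P.weylGroupToPerm w j) r := by
  rw [mul_inv_eq_iff_eq_mul]
  apply LinearEquiv.ext
  intro v
  rw [LinearEquiv.mul_apply, LinearEquiv.mul_apply, affineReflection_apply, affineReflection_apply,
    map_sub, map_smul, finiteHom_apply, finiteHom_apply, ← coweightAction_coroot,
    toLinearMap_smul_coweightAction, smul_root]

lemma translation_conj_affineReflection (q : N) (j : ι) (r : ℝ) :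
    translation P q * affineReflection P j r * (translation P q)⁻¹ =
      affineReflection P j (r - P.toLinearMap (P.root j) q) := by
  rw [mul_inv_eq_iff_eq_mul]
  apply LinearEquiv.ext
  intro v
  rw [LinearEquiv.mul_apply, LinearEquiv.mul_apply, affineReflection_apply, affineReflection_apply,
    map_sub, map_smul, translation_apply, translation_apply]

lemma affineReflection_zero (j : ι) :
    affineReflection P j 0 = finiteHom P (weylGroup.ofIdx P j) := by
  apply LinearEquiv.ext
  intro v
  rw [affineReflection_apply, finiteHom_apply, weylGroup.ofIdx_smul, Equiv.reflection_smul,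
    RootPairing.reflection_apply]
  ext <;> simp [RootPairing.coroot']

lemma exists_int_toLinearMap_eq [P.IsCrystallographic] {q : N} (hq : q ∈ P.corootSpan ℤ) (j : ι) :
    ∃ z : ℤ, P.toLinearMap (P.root j) q = z := by
  induction hq using Submodule.span_induction with
  | mem x h =>
    obtain ⟨i, rfl⟩ := h
    exact ⟨P.pairingIn ℤ j i, (P.algebraMap_pairingIn ℤ j i).symm⟩
  | zero => exact ⟨0, by simp⟩
  | add x y _ _ hx hy =>
    obtain ⟨a, ha⟩ := hx
    obtain ⟨c, hc⟩ := hy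
    exact ⟨a + c, by simp [ha, hc]⟩
  | smul z x _ hx =>
    obtain ⟨a, ha⟩ := hx
    exact ⟨z * a, by simp [ha]⟩

end Action

/-! ### The identification of the affine Weyl group with the semidirect product -/

section Iso

variable {P : RootPairing ι ℝ M N} (b : P.Base) (θ : ι)

lemma root_reflectionPerm_self (i : ι) : P.root (P.reflectionPerm i i) = -P.root i := by
  rw [P.root_reflectionPerm, P.reflection_apply_self]

lemma coroot_reflectionPerm_self (i : ι) : P.coroot (P.reflectionPerm i i) = -P.coroot i := by
  rw [P.coroot_reflectionPerm, P.coreflection_apply_self]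

lemma simpleReflection_some (i : b.support) :
    simpleReflection b θ (some i) = affineReflection P i 0 := rfl

lemma simpleReflection_none :
    simpleReflection b θ none = affineReflection P (P.reflectionPerm θ θ) 1 := by
  apply LinearEquiv.ext
  intro v
  rw [affineReflection_apply, root_reflectionPerm_self, coroot_reflectionPerm_self, map_neg]
  rfl

lemma affineReflection_reflectionPerm_self (i : ι) (r : ℝ) :
    affineReflection P (P.reflectionPerm i i) r = affineReflection P i (-r) := by
  apply LinearEquiv.ext
  intro v
  rw [affineReflection_apply, affineReflection_apply, root_reflectionPerm_self,
    coroot_reflectionPerm_self, map_neg, neg_smul, ← smul_neg, Prod.neg_mk, neg_neg]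

lemma simpleReflection_none_eq_mul :
    simpleReflection b θ none = finiteHom P (weylGroup.ofIdx P θ) *
      translation P (-P.coroot θ) := by
  apply LinearEquiv.ext
  intro v
  rw [simpleReflection_none, affineReflection_reflectionPerm_self, affineReflection_apply,
    LinearEquiv.mul_apply, finiteHom_apply, translation_apply, weylGroup.ofIdx_smul,
    Equiv.reflection_smul, RootPairing.reflection_apply]
  ext <;> simp [RootPairing.coroot']

/-! ### Coefficients and pairings of the highest root -/

variable {b} in
lemma repr_nonneg_of_mem_closure [P.IsRootSystem] {x : M}
    (hx : x ∈ AddSubmonoid.closure (P.root '' b.support)) (k : b.support) :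
    0 ≤ b.toWeightBasis.repr x k := by
  classical
  induction hx using AddSubmonoid.closure_induction with
  | mem x hx =>
    obtain ⟨i, hi, rfl⟩ := hx
    rw [b.toWeightBasis_repr_root ⟨i, hi⟩, Finsupp.single_apply]
    split_ifs <;> simp
  | zero => simp
  | add x y _ _ hx hy => simpa using add_nonneg hx hy

variable {b θ}

lemma IsHighestRoot.repr_le [P.IsRootSystem] (hθ : IsHighestRoot b θ) (i : ι) (k : b.support) :
    b.toWeightBasis.repr (P.root i) k ≤ b.toWeightBasis.repr (P.root θ) k := by
  simpa using repr_nonneg_of_mem_closure (hθ i) k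

lemma IsHighestRoot.neg_repr_le [P.IsRootSystem] (hθ : IsHighestRoot b θ) (i : ι) (k : b.support) :
    -b.toWeightBasis.repr (P.root i) k ≤ b.toWeightBasis.repr (P.root θ) k := by
  simpa [root_reflectionPerm_self] using hθ.repr_le (P.reflectionPerm i i) k

lemma IsHighestRoot.repr_nonneg [P.IsRootSystem] (hθ : IsHighestRoot b θ) (k : b.support) :
    0 ≤ b.toWeightBasis.repr (P.root θ) k := by
  linarith [hθ.neg_repr_le θ k]

/-- With `c` the pairing, `cθ - α_i` is minus a root, hence at most `θ` coefficientwise. So `(c -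
1)θ ≤ α_i ≤ θ`, and `c ≥ 2` with `θ ≥ 0` forces equality. -/
lemma IsHighestRoot.eq_of_two_le_pairing [P.IsRootSystem] (hθ : IsHighestRoot b θ) {i : ι}
    (hi : 2 ≤ P.pairing i θ) : i = θ := by
  refine P.root.injective (b.toWeightBasis.ext_elem fun k ↦ ?_)
  have h₁ := hθ.repr_le i k
  have h₂ := hθ.neg_repr_le (P.reflectionPerm θ i) k
  have h₃ := hθ.repr_nonneg k
  rw [P.root_reflectionPerm, P.reflection_apply_root] at h₂
  simp only [map_sub, map_smul, Finsupp.coe_sub, Finsupp.coe_smul, Pi.sub_apply, Pi.smul_apply,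
    smul_eq_mul] at h₂
  nlinarith

lemma IsHighestRoot.pairing_cases [P.IsRootSystem] [P.IsCrystallographic]
    (hθ : IsHighestRoot b θ) (i : ι) :
    i = θ ∨ i = P.reflectionPerm θ θ ∨ P.pairing i θ = 0 ∨ P.pairing i θ = 1 ∨
      P.pairing i θ = -1 := by
  have hz : P.pairing i θ = (P.pairingIn ℤ i θ : ℝ) := (P.algebraMap_pairingIn ℤ i θ).symm
  by_cases h₁ : 2 ≤ P.pairingIn ℤ i θ
  · exact Or.inl (hθ.eq_of_two_le_pairing (by rw [hz]; exact_mod_cast h₁))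
  by_cases h₂ : P.pairingIn ℤ i θ ≤ -2
  · right; left
    have := hθ.eq_of_two_le_pairing (i := P.reflectionPerm i i) (by
      rw [P.pairing_reflectionPerm_self_left, hz]
      have : ((P.pairingIn ℤ i θ : ℤ) : ℝ) ≤ -2 := by exact_mod_cast h₂
      linarith)
    apply P.root.injective
    rw [root_reflectionPerm_self, ← this, root_reflectionPerm_self, neg_neg]
  · have : P.pairingIn ℤ i θ = 0 ∨ P.pairingIn ℤ i θ = 1 ∨ P.pairingIn ℤ i θ = -1 := by omega
    right; right
    rw [hz]
    exact_mod_cast this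

/-! ### Translations by coroots inside the affine Weyl group -/

variable (θ) in
-- The orbit of `θ^∨` spans a nonzero stable subspace, which is everything by irreducibility,
-- whereas `α_j` does not vanish on `α_j^∨`.
lemma exists_toLinearMap_coweightAction_coroot_ne_zero [P.IsRootSystem] [P.IsIrreducible] (j : ι) :
    ∃ w : P.weylGroup, P.toLinearMap (P.root j) (coweightAction P w (P.coroot θ)) ≠ 0 := by
  by_contra! hzero
  set S : Submodule ℝ N :=
    Submodule.span ℝ (Set.range fun w : P.weylGroup ↦ coweightAction P w (P.coroot θ))
  have hS : S = ⊤ := by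
    refine IsIrreducible.eq_top_of_invtSubmodule_coreflection (P := P) S (fun i ↦ ?_) ?_
    · rw [Module.End.mem_invtSubmodule, Submodule.span_le]
      rintro - ⟨w, rfl⟩
      refine Submodule.subset_span ⟨weylGroup.ofIdx P i * w, ?_⟩
      simp [coweightAction_ofIdx]
    · intro h
      have : P.coroot θ ∈ S := Submodule.subset_span ⟨1, by simp⟩
      rw [h, Submodule.mem_bot] at this
      have h2 := P.root_coroot_two θ
      rw [this] at h2
      simp at h2
  have hker : S ≤ LinearMap.ker (P.toLinearMap (P.root j)) := by
    rw [Submodule.span_le]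
    rintro - ⟨w, rfl⟩
    exact hzero w
  have h2 := P.root_coroot_two j
  have := hker (hS ▸ Submodule.mem_top : P.coroot j ∈ S)
  rw [LinearMap.mem_ker] at this
  linarith

variable (b θ) in
lemma simpleReflection_mem (i : Option b.support) : simpleReflection b θ i ∈ affineWeylGroup b θ :=
  Subgroup.subset_closure ⟨i, rfl⟩

variable (b θ) in
lemma finiteHom_mem [Finite ι] [P.IsCrystallographic] [P.IsReduced] (w : P.weylGroup) :
    finiteHom P w ∈ affineWeylGroup b θ := by
  have hrefl : ∀ i, finiteHom P (weylGroup.ofIdx P i) ∈ affineWeylGroup b θ := fun i ↦ by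
    rw [← affineReflection_zero]
    induction i using RootPairing.Base.induction_reflect (b := b) with
    | h₀ i hi => rwa [affineReflection_reflectionPerm_self, neg_zero]
    | h₁ i hi => exact simpleReflection_mem b θ (some ⟨i, hi⟩)
    | h₂ i j hi hj =>
      have := finiteHom_conj_affineReflection P (weylGroup.ofIdx P j) i 0
      rw [← affineReflection_zero] at this
      change _ = affineReflection P (P.reflectionPerm j i) 0 at this
      rw [← this]
      have hj' := simpleReflection_mem b θ (some ⟨j, hj⟩)
      exact mul_mem (mul_mem hj' hi) (inv_mem hj')
  obtain ⟨w, hw⟩ := w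
  induction hw using weylGroup.induction with
  | mem i => exact hrefl i
  | one => exact (map_one (finiteHom P)) ▸ one_mem _
  | mul x y hx hy hx' hy' =>
    rw [← Submonoid.mk_mul_mk _ _ _ hx hy]
    exact (map_mul (finiteHom P) ⟨x, hx⟩ ⟨y, hy⟩) ▸ mul_mem hx' hy'

lemma translation_coweightAction_mem [Finite ι] [P.IsCrystallographic] [P.IsReduced] {q : N}
    (hq : translation P q ∈ affineWeylGroup b θ) (w : P.weylGroup) :
    translation P (coweightAction P w q) ∈ affineWeylGroup b θ := by
  rw [← finiteHom_conj_translation]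
  have hw := finiteHom_mem b θ w
  exact mul_mem (mul_mem hw hq) (inv_mem hw)

variable (b θ) in
lemma translation_coroot_self_mem [Finite ι] [P.IsCrystallographic] [P.IsReduced] :
    translation P (P.coroot θ) ∈ affineWeylGroup b θ := by
  have h1 := simpleReflection_mem b θ none
  rw [simpleReflection_none_eq_mul, Subgroup.mul_mem_cancel_left _ (finiteHom_mem b θ _),
    translation_neg] at h1
  exact inv_mem_iff.mp h1

/-- Choose a conjugate `wθ^∨` not orthogonal to `α_j`. Either `α_j^∨ = ±wθ^∨`, or the pairing is
`±1` and `α_j^∨` is, up to sign, the difference of `wθ^∨` and its image under `s_j`. -/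
lemma translation_coroot_mem [Finite ι] [P.IsRootSystem] [P.IsCrystallographic] [P.IsReduced]
    [P.IsIrreducible] (hθ : IsHighestRoot b θ) (j : ι) :
    translation P (P.coroot j) ∈ affineWeylGroup b θ := by
  obtain ⟨w, hw⟩ := exists_toLinearMap_coweightAction_coroot_ne_zero (P := P) θ j
  have hmem := translation_coweightAction_mem (translation_coroot_self_mem b θ) w
  set i := P.weylGroupToPerm w⁻¹ j with hi
  have hpair : P.toLinearMap (P.root j) (coweightAction P w (P.coroot θ)) = P.pairing i θ := by
    rw [toLinearMap_coweightAction, smul_root]; rfl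
  have hij : coweightAction P w (P.coroot i) = P.coroot j := by
    rw [hi, ← coweightAction_coroot, ← LinearEquiv.mul_apply, ← map_mul]
    simp
  have hrefl := translation_coweightAction_mem hmem (weylGroup.ofIdx P j)
  rw [coweightAction_ofIdx, coreflection_apply, sub_eq_add_neg, translation_add,
    Subgroup.mul_mem_cancel_left _ hmem, translation_neg, inv_mem_iff] at hrefl
  change translation P (P.toLinearMap (P.root j) (coweightAction P w (P.coroot θ)) • P.coroot j)
    ∈ _ at hrefl
  rw [hpair] at hrefl hw
  rcases hθ.pairing_cases i with h | h | h | h | h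
  · rwa [← hij, h]
  · rw [← hij, h, coroot_reflectionPerm_self, map_neg, translation_neg]
    exact inv_mem hmem
  · exact absurd h hw
  · rwa [h, one_smul] at hrefl
  · rwa [h, neg_one_smul, translation_neg, inv_mem_iff] at hrefl

lemma translation_mem [Finite ι] [P.IsRootSystem] [P.IsCrystallographic] [P.IsReduced]
    [P.IsIrreducible] (hθ : IsHighestRoot b θ) {q : N} (hq : q ∈ P.corootSpan ℤ) :
    translation P q ∈ affineWeylGroup b θ := by
  rw [← Submodule.mem_toAddSubgroup, corootSpan, Submodule.span_int_eq_addSubgroupClosure] at hq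
  induction hq using AddSubgroup.closure_induction with
  | mem x h =>
    obtain ⟨i, rfl⟩ := h
    exact translation_coroot_mem hθ i
  | zero => rw [translation_zero]; exact one_mem _
  | add x y _ _ hx hy => rw [translation_add]; exact mul_mem hx hy
  | neg x _ hx => rw [translation_neg]; exact inv_mem hx

lemma range_semidirectHom [Finite ι] [P.IsRootSystem] [P.IsCrystallographic] [P.IsReduced]
    [P.IsIrreducible] (hθ : IsHighestRoot b θ) :
    (semidirectHom P).range = affineWeylGroup b θ := by
  apply le_antisymm
  · rintro - ⟨x, rfl⟩
    exact mul_mem (translation_mem hθ (Subtype.prop _)) (finiteHom_mem b θ _)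
  · rw [affineWeylGroup, Subgroup.closure_le]
    rintro - ⟨i | i, rfl⟩
    · refine ⟨SemidirectProduct.inr (weylGroup.ofIdx P θ) *
        latticeElt P (-P.corootSpanMem ℤ θ), ?_⟩
      rw [map_mul, semidirectHom_inr, semidirectHom_latticeElt, simpleReflection_none_eq_mul]
      rfl
    · exact ⟨SemidirectProduct.inr (weylGroup.ofIdx P i), by
        rw [semidirectHom_inr, simpleReflection_some, affineReflection_zero]⟩

/-- The standard identification of the affine Weyl group with `W₀ ⋉ Λ₀^∨`. -/
def standardIso [Finite ι] [P.IsRootSystem] [P.IsCrystallographic] [P.IsReduced]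
    [P.IsIrreducible] (hθ : IsHighestRoot b θ) : affineWeylGroup b θ ≃* SemidirectWeyl P :=
  ((MonoidHom.ofInjective (semidirectHom_injective P)).trans
    (MulEquiv.subgroupCongr (range_semidirectHom hθ))).symm

section

variable [Finite ι] [P.IsRootSystem] [P.IsCrystallographic] [P.IsReduced] [P.IsIrreducible]
  (hθ : IsHighestRoot b θ)

lemma coe_standardIso_symm (x : SemidirectWeyl P) :
    ((standardIso hθ).symm x : (M × ℝ) ≃ₗ[ℝ] (M × ℝ)) = semidirectHom P x := rfl

lemma coe_eq_semidirectHom (g : affineWeylGroup b θ) :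
    (g : (M × ℝ) ≃ₗ[ℝ] (M × ℝ)) = semidirectHom P (standardIso hθ g) := by
  rw [← coe_standardIso_symm hθ, MulEquiv.symm_apply_apply]

lemma isStandardIso_standardIso : IsStandardIso b θ (standardIso hθ) := by
  refine ⟨fun i ↦ semidirectHom_injective P ?_, semidirectHom_injective P ?_⟩
  · rw [← coe_eq_semidirectHom, semidirectHom_inr, ← affineReflection_zero]
    rfl
  · rw [← coe_eq_semidirectHom, map_mul, semidirectHom_inr, semidirectHom_latticeElt]
    exact simpleReflection_none_eq_mul b θ

end

end Iso

/-! ### The geometric representation of the affine Weyl group -/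

section Geometric

variable {P : RootPairing ι ℝ M N} (b : P.Base) (θ : ι)

/-- The shear `(m, t) ↦ (m + t x, t)` of `M × ℝ`. -/
def shear (x : M) : (M × ℝ) ≃ₗ[ℝ] (M × ℝ) where
  toFun v := (v.1 + v.2 • x, v.2)
  invFun v := (v.1 - v.2 • x, v.2)
  map_add' v w := by ext <;> simp [add_smul]; abel
  map_smul' c v := by ext <;> simp [mul_smul]
  left_inv v := by simp
  right_inv v := by simp

/-- The basis of `M × ℝ` formed by the simple roots of the extended Dynkin diagram. -/
def affineBasis [P.IsRootSystem] : Basis (Option b.support) ℝ (M × ℝ) :=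
  ((b.toWeightBasis.prod (Basis.singleton Unit ℝ)).reindex
    (Equiv.optionEquivSumPUnit _).symm).map (shear (P.root θ)).symm

/-- Substitute `δ = α₀ + θ` in `m + tδ`. -/
lemma affineBasis_repr_some [P.IsRootSystem] (v : M × ℝ) (k : b.support) :
    (affineBasis b θ).repr v (some k) =
      b.toWeightBasis.repr v.1 k + v.2 * b.toWeightBasis.repr (P.root θ) k := by
  simp [affineBasis, shear]

lemma affineBasis_repr_none [P.IsRootSystem] (v : M × ℝ) :
    (affineBasis b θ).repr v none = v.2 := by
  simp [affineBasis, shear]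

lemma affineBasis_apply [P.IsRootSystem] (i : Option b.support) :
    affineBasis b θ i = simpleRoot b θ i := by
  cases i <;> simp [affineBasis, shear, simpleRoot]

/-- The finite part and the `δ`-coefficient of a simple root of the extended diagram. -/
def simpleIdx : Option b.support → ι × ℤ
  | some i => (i, 0)
  | none => (P.reflectionPerm θ θ, 1)

lemma affineBasis_eq [P.IsRootSystem] (i : Option b.support) :
    affineBasis b θ i = (P.root (simpleIdx b θ i).1, ((simpleIdx b θ i).2 : ℝ)) := by
  rw [affineBasis_apply]
  cases i <;> simp [simpleIdx, simpleRoot]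

lemma simpleReflection_eq (i : Option b.support) :
    simpleReflection b θ i = affineReflection P (simpleIdx b θ i).1 (simpleIdx b θ i).2 := by
  cases i
  · simp [simpleIdx, simpleReflection_none]
  · simp [simpleIdx, simpleReflection_some]

/-- The real affine roots `α + n δ`. -/
def affineRoots (P : RootPairing ι ℝ M N) : Set (M × ℝ) :=
  {v | ∃ (j : ι) (n : ℤ), v = (P.root j, (n : ℝ))}

variable {b θ}

lemma gen_mul_self (i : Option b.support) : gen b θ i * gen b θ i = 1 :=
  Subtype.ext (LinearEquiv.ext fun v ↦
    Module.involutive_reflection (simpleCoroot_simpleRoot b θ i) v)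

lemma exists_word (g : affineWeylGroup b θ) :
    ∃ l : List (Option b.support), (l.map (gen b θ)).prod = g := by
  have hg : g ∈ parabolic (gen b θ) Set.univ := by
    have : gen b θ '' Set.univ = Subtype.val ⁻¹' Set.range (simpleReflection b θ) := by
      ext x
      simp [gen, Subtype.ext_iff]
    rw [parabolic, this]
    exact (Subgroup.closure_closure_coe_preimage (k := Set.range (simpleReflection b θ))) ▸
      Subgroup.mem_top g
  obtain ⟨l, -, hl⟩ := exists_word_of_mem_parabolic gen_mul_self hg
  exact ⟨l, hl⟩

/-- Write `α + nδ = nα₀ + (α + nθ)`. The coefficients of `α` lie between those of `-θ` and `θ`, so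
the sign of `n ≠ 0` decides; for `n = 0` the base does. -/
lemma affineRoots_mem_cone [P.IsRootSystem] (hθ : IsHighestRoot b θ) {v : M × ℝ}
    (hv : v ∈ affineRoots P) :
    v ∈ cone (affineBasis b θ) Set.univ ∨ -v ∈ cone (affineBasis b θ) Set.univ := by
  obtain ⟨j, n, rfl⟩ := hv
  have hcone : ∀ v : M × ℝ, (0 ≤ v.2 ∧ ∀ k, 0 ≤ b.toWeightBasis.repr v.1 k +
      v.2 * b.toWeightBasis.repr (P.root θ) k) → v ∈ cone (affineBasis b θ) Set.univ := by
    rintro v ⟨h₁, h₂⟩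
    refine ⟨fun k ↦ ?_, by simp⟩
    rcases k with - | k
    · rwa [affineBasis_repr_none]
    · rw [affineBasis_repr_some]; exact h₂ k
  rcases lt_trichotomy n 0 with hn | rfl | hn
  · right
    have hn' : (n : ℝ) ≤ -1 := by exact_mod_cast (by omega : n ≤ -1)
    refine hcone _ ⟨by simp; linarith, fun k ↦ ?_⟩
    have h₁ := hθ.repr_le j k
    have h₂ := hθ.repr_nonneg k
    simp only [Prod.neg_mk, map_neg, Finsupp.coe_neg, Pi.neg_apply]
    nlinarith
  · refine (b.root_mem_or_neg_mem j).imp (fun h ↦ hcone _ ⟨by simp, fun k ↦ ?_⟩)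
      (fun h ↦ hcone _ ⟨by simp, fun k ↦ ?_⟩)
    · simpa using repr_nonneg_of_mem_closure h k
    · simpa using repr_nonneg_of_mem_closure h k
  · left
    have hn' : (1 : ℝ) ≤ n := by exact_mod_cast (by omega : 1 ≤ n)
    refine hcone _ ⟨by simp; linarith, fun k ↦ ?_⟩
    have h₁ := hθ.neg_repr_le j k
    have h₂ := hθ.repr_nonneg k
    nlinarith

lemma eq_one_or_neg_one_of_smul_root_eq [P.IsReduced] {i j : ι} {c : ℝ}
    (h : c • P.root i = P.root j) : c = 1 ∨ c = -1 := by
  have hdep : ¬ LinearIndependent ℝ ![P.root i, P.root j] := fun hli ↦ by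
    have := LinearIndependent.pair_iff.mp hli c (-1) (by simp [h])
    simp at this
  have hne := P.ne_zero i
  refine (IsReduced.eq_or_eq_neg (P := P) i j hdep).imp (fun hij ↦ ?_) fun hij ↦ ?_
  · exact smul_left_injective ℝ hne (by simpa only [one_smul, ← hij] using h)
  · exact smul_left_injective ℝ hne (by simp only [neg_one_smul]; rw [h, hij, neg_neg])

variable [Finite ι] [P.IsRootSystem] [P.IsCrystallographic] [P.IsReduced] [P.IsIrreducible]

lemma isGeometricRep (hθ : IsHighestRoot b θ) :
    IsGeometricRep (gen b θ) (affineWeylGroup b θ).subtype (affineBasis b θ) (affineRoots P) where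
  mul_self := gen_mul_self
  exists_word := exists_word
  basis_mem i := ⟨_, _, affineBasis_eq b θ i⟩
  map_mem g := by
    rintro - ⟨j, n, rfl⟩
    set x := standardIso hθ g
    obtain ⟨z, hz⟩ := exists_int_toLinearMap_eq P (x.left.toAdd).2 (P.weylGroupToPerm x.right j)
    -- The shift stays integral because roots take integer values on the coroot lattice.
    refine ⟨P.weylGroupToPerm x.right j, n - z, ?_⟩
    rw [Subgroup.subtype_apply, coe_eq_semidirectHom hθ, semidirectHom_apply,
      LinearEquiv.mul_apply, finiteHom_apply, translation_apply, smul_root, hz, Int.cast_sub]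
  mem_or_neg_mem _ := affineRoots_mem_cone hθ
  smul_mem i c := by
    rintro ⟨j, n, h⟩
    rw [affineBasis_eq, Prod.smul_mk, Prod.mk.injEq] at h
    exact eq_one_or_neg_one_of_smul_root_eq h.1
  apply_eq i v := by
    refine ⟨-(simpleCoroot b θ i v), ?_⟩
    rw [affineBasis_apply, neg_smul, ← sub_eq_add_neg]
    rfl
  apply_self i := by
    rw [affineBasis_apply]
    exact Module.reflection_apply_self (simpleCoroot_simpleRoot b θ i)
  conj_eq g i j h := by
    set x := standardIso hθ g
    rw [Subgroup.subtype_apply, coe_eq_semidirectHom hθ, semidirectHom_apply,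
      LinearEquiv.mul_apply, affineBasis_eq, affineBasis_eq, finiteHom_apply, translation_apply,
      smul_root, Prod.mk.injEq] at h
    refine Subtype.ext ?_
    rw [Subgroup.coe_mul, Subgroup.coe_mul, Subgroup.coe_inv, coe_eq_semidirectHom hθ g,
      semidirectHom_apply]
    change _ * simpleReflection b θ i * _ = simpleReflection b θ j
    -- The finite part and the translation part of `g` both carry affine reflections to affine
    -- reflections, so the reflection is determined by the image of its root.
    rw [simpleReflection_eq, simpleReflection_eq, ← h.2, ← P.root.injective h.1,
      ← translation_conj_affineReflection, ← finiteHom_conj_affineReflection]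
    group

end Geometric

/-! ### The translation attached to a cominuscule simple root -/

section Cominuscule

variable {P : RootPairing ι ℝ M N} {b : P.Base} {θ : ι}

lemma some_mem_J {d j : b.support} (h : j ≠ d) : some j ∈ J b d := by
  simp [J, D₀, Dd, h]

lemma J_subset_D₀ (d : b.support) : J b d ⊆ D₀ b := Set.inter_subset_left

lemma J_subset_Dd (d : b.support) : J b d ⊆ Dd b d := Set.inter_subset_right

lemma translation_coweightAction_sub (w : P.weylGroup) (q : N) :
    translation P (coweightAction P w q - q) =
      finiteHom P w * translation P q * (finiteHom P w)⁻¹ * (translation P q)⁻¹ := by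
  rw [finiteHom_conj_translation, sub_eq_add_neg, translation_add, translation_neg]

variable [P.IsRootSystem]

lemma toLinearMap_fundamentalCoweight (d : b.support) (m : M) :
    P.toLinearMap m (fundamentalCoweight b d) = b.toWeightBasis.repr m d :=
  LinearMap.congr_fun
    (P.flip.toLinearMap.toPerfPair.apply_symm_apply (b.toWeightBasis.coord d)) m

lemma translation_fundamentalCoweight_basis {d : b.support} {j : Option b.support}
    (hj : j ∈ J b d) :
    translation P (fundamentalCoweight b d) (affineBasis b θ j) = affineBasis b θ j := by
  rcases j with - | j
  · exact absurd rfl hj.1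
  · have hjd : j ≠ d := by rintro rfl; exact hj.2 rfl
    rw [affineBasis_apply]
    simp [simpleRoot, toLinearMap_fundamentalCoweight, hjd]

lemma exists_int_repr (b : P.Base) (d : b.support) (i : ι) :
    ∃ z : ℤ, b.toWeightBasis.repr (P.root i) d = z := by
  have h := b.root_mem_span_int i
  generalize P.root i = x at h
  induction h using Submodule.span_induction with
  | mem x h =>
    classical
    obtain ⟨j, hj, rfl⟩ := h
    rw [b.toWeightBasis_repr_root ⟨j, hj⟩, Finsupp.single_apply]
    split_ifs
    exacts [⟨1, by simp⟩, ⟨0, by simp⟩]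
  | zero => exact ⟨0, by simp⟩
  | add x y _ _ hx hy =>
    obtain ⟨a, ha⟩ := hx
    obtain ⟨c, hc⟩ := hy
    exact ⟨a + c, by simp [ha, hc]⟩
  | smul z x _ hx =>
    obtain ⟨a, ha⟩ := hx
    exact ⟨z * a, by simp [ha]⟩

/-- For a reflection the difference is an integer multiple of a coroot; products follow from `xyϖ -
ϖ = x(yϖ - ϖ) + (xϖ - ϖ)`. -/
lemma coweightAction_fundamentalCoweight_sub_mem (d : b.support) (w : P.weylGroup) :
    coweightAction P w (fundamentalCoweight b d) - fundamentalCoweight b d ∈ P.corootSpan ℤ := by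
  obtain ⟨w, hw⟩ := w
  induction hw using weylGroup.induction with
  | mem i =>
    have := coweightAction_ofIdx P i (fundamentalCoweight b d)
    change coweightAction P (weylGroup.ofIdx P i) _ - _ ∈ _
    rw [this, coreflection_apply, sub_sub_cancel_left]
    change -(P.toLinearMap (P.root i) (fundamentalCoweight b d) • P.coroot i) ∈ _
    obtain ⟨z, hz⟩ := exists_int_repr b d i
    rw [toLinearMap_fundamentalCoweight, hz, Int.cast_smul_eq_zsmul]
    exact neg_mem (Submodule.smul_mem _ z (Submodule.subset_span ⟨i, rfl⟩))
  | one =>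
    rw [← Submonoid.one_def, map_one]
    simp
  | mul x y hx hy hx' hy' =>
    rw [← Submonoid.mk_mul_mk _ _ _ hx hy, map_mul, LinearEquiv.mul_apply]
    have := add_mem (coweightAction_mem P ⟨x, hx⟩ hy') hx'
    rwa [map_sub, sub_add_sub_cancel] at this

variable [Finite ι] [P.IsCrystallographic] [P.IsReduced] [P.IsIrreducible]

lemma standardIso_eq_inr (hθ : IsHighestRoot b θ) {w : affineWeylGroup b θ}
    (hw : w ∈ parabolic (gen b θ) (D₀ b)) :
    standardIso hθ w = SemidirectProduct.inr (standardIso hθ w).right := by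
  have hle : parabolic (gen b θ) (D₀ b) ≤
      (SemidirectProduct.inr (φ := corootLatticeAction P)).range.comap
        (standardIso hθ).toMonoidHom := by
    rw [parabolic, Subgroup.closure_le]
    rintro - ⟨i | i, hi, rfl⟩
    · exact absurd rfl hi
    · exact ⟨_, ((isStandardIso_standardIso hθ).1 i).symm⟩
  obtain ⟨x, hx⟩ := hle hw
  change _ = standardIso hθ w at hx
  rw [← hx, SemidirectProduct.right_inr]

lemma coe_eq_finiteHom (hθ : IsHighestRoot b θ) {w : affineWeylGroup b θ}
    (hw : w ∈ parabolic (gen b θ) (D₀ b)) :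
    (w : (M × ℝ) ≃ₗ[ℝ] (M × ℝ)) = finiteHom P (standardIso hθ w).right := by
  rw [coe_eq_semidirectHom hθ, standardIso_eq_inr hθ hw, semidirectHom_inr,
    SemidirectProduct.right_inr]

/-- The longest element of `W_J` exchanges the highest root and the cominuscule simple root. -/
lemma longest_apply_highest (hθ : IsHighestRoot b θ) {d : b.support} (hd : IsCominuscule b θ d)
    {u : affineWeylGroup b θ} (hu : IsLongest (gen b θ) (J b d) u) :
    u.1 (P.root θ, 0) = (P.root d, 0) := by
  have h := isGeometricRep hθ
  have hd' : b.toWeightBasis.repr (P.root θ) d = 1 := hd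
  have hnotMem : some d ∉ J b d := by simp [J, Dd]
  -- One strictly positive coefficient makes a root positive.
  have hpos : ∀ i : ι, b.toWeightBasis.repr (P.root i) d = 1 → ∀ k,
      0 ≤ b.toWeightBasis.repr (P.root i) k := by
    intro i hi k
    rcases b.root_mem_or_neg_mem i with hi' | hi'
    · exact repr_nonneg_of_mem_closure hi' k
    · have := repr_nonneg_of_mem_closure hi' d
      simp only [map_neg, Finsupp.coe_neg, Pi.neg_apply, hi] at this
      linarith
  have hcone : ∀ m : M, b.toWeightBasis.repr m d = 0 →
      (∀ k, k ≠ d → 0 ≤ b.toWeightBasis.repr m k) →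
      (m, (0 : ℝ)) ∈ cone (affineBasis b θ) (J b d) := by
    intro m hm hm'
    refine ⟨fun k ↦ ?_, fun k hk ↦ ?_⟩
    · rcases k with - | k
      · simp [affineBasis_repr_none]
      · by_cases hkd : k = d
        · subst hkd; simp [affineBasis_repr_some, hm]
        · simpa [affineBasis_repr_some] using hm' k hkd
    · rcases k with - | k
      · simp [affineBasis_repr_none]
      · have hkd : k = d := by
          by_contra hkd
          exact hk (some_mem_J hkd)
        subst hkd
        simp [affineBasis_repr_some, hm]
  have huu : ∀ v, u.1 (u.1 v) = v := h.apply_apply_of_isLongest hu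
  have hu₀ := coe_eq_finiteHom hθ (parabolic_mono _ (J_subset_D₀ d) hu.1)
  set w := (standardIso hθ u).right
  have hroot : ∀ i, u.1 (P.root i, 0) = (P.root (P.weylGroupToPerm w i), 0) := fun i ↦ by
    rw [hu₀, finiteHom_apply, smul_root]
  have hcoord : ∀ i, b.toWeightBasis.repr (P.root (P.weylGroupToPerm w i)) d =
      b.toWeightBasis.repr (P.root i) d := fun i ↦ by
    have := h.repr_apply_of_mem_parabolic hu.1 (P.root i, 0) hnotMem
    rw [Subgroup.subtype_apply, hroot, affineBasis_repr_some, affineBasis_repr_some] at this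
    simpa using this
  -- Since `u` preserves the `α_d`-coefficient, `uθ` is a positive root with coefficient one there,
  -- so `uθ - α_d` is supported on `J`.
  have h₁ : (P.root (P.weylGroupToPerm w θ) - P.root d, (0 : ℝ)) ∈
      cone (affineBasis b θ) (J b d) := by
    have hθd := (hcoord θ).trans hd'
    refine hcone _ (by rw [map_sub, Finsupp.sub_apply, hθd]; simp) fun k hk ↦ ?_
    simpa [hk.symm] using hpos _ hθd k
  have h₂ : (P.root θ - P.root (P.weylGroupToPerm w d), (0 : ℝ)) ∈
      cone (affineBasis b θ) (J b d) := by
    refine hcone _ (by rw [map_sub, Finsupp.sub_apply, hcoord]; simp [hd']) fun k _ ↦ ?_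
    simpa using hθ.repr_le (P.weylGroupToPerm w d) k
  -- Applying `-u` to `θ - uα_d ≥ 0` gives `α_d - uθ ≥ 0`, the opposite of `h₁`; hence equality.
  have h₃ := neg_map_mem_cone u.1.toLinearMap
    (fun j hj ↦ h.neg_apply_mem_of_isLongest hu hj) h₂
  have h₄ : u.1 (P.root θ - P.root (P.weylGroupToPerm w d), (0 : ℝ)) =
      (P.root (P.weylGroupToPerm w θ) - P.root d, 0) := by
    have : (P.root θ - P.root (P.weylGroupToPerm w d), (0 : ℝ)) =
        (P.root θ, 0) - u.1 (P.root d, 0) := by rw [hroot]; simp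
    rw [this, map_sub, huu, hroot]
    simp
  rw [LinearEquiv.coe_coe, h₄] at h₃
  have h₅ := congrArg Prod.fst (eq_zero_of_mem_cone_of_neg_mem_cone h₁ h₃)
  rw [hroot, sub_eq_zero.mp h₅]

/-- Conjugation by `w_J τ_{ϖ_d^∨}` maps `W₀` into `W_{D_d}`. -/
lemma conj_mem_parabolic (hθ : IsHighestRoot b θ) {d : b.support} (hd : IsCominuscule b θ d)
    {u : affineWeylGroup b θ} (hu : IsLongest (gen b θ) (J b d) u) {x : affineWeylGroup b θ}
    (hx : x ∈ parabolic (gen b θ) (D₀ b)) :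
    ∃ y ∈ parabolic (gen b θ) (Dd b d),
      y.1 = u.1 * translation P (fundamentalCoweight b d) * x.1 *
        (u.1 * translation P (fundamentalCoweight b d))⁻¹ := by
  have h := isGeometricRep hθ
  induction hx using Subgroup.closure_induction with
  | mem x hx =>
    obtain ⟨i | i, hi, rfl⟩ := hx
    · exact absurd rfl hi
    have hconj : translation P (fundamentalCoweight b d) * (gen b θ (some i)).1 *
        (translation P (fundamentalCoweight b d))⁻¹ =
        affineReflection P i (-b.toWeightBasis.repr (P.root i) d) := by
      change _ * simpleReflection b θ (some i) * _ = _
      rw [simpleReflection_some, translation_conj_affineReflection,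
        toLinearMap_fundamentalCoweight, zero_sub]
    have hassoc : u.1 * translation P (fundamentalCoweight b d) * (gen b θ (some i)).1 *
        (u.1 * translation P (fundamentalCoweight b d))⁻¹ =
        u.1 * affineReflection P i (-b.toWeightBasis.repr (P.root i) d) * u.1⁻¹ := by
      rw [← hconj]; group
    rw [hassoc]
    by_cases hid : i = d
    · subst hid
      -- `T` turns `s_d` into the reflection in `α_d - δ`, and `u` turns that into the reflection in
      -- `θ - δ = -α₀`, which is `s₀`.
      refine ⟨gen b θ none, mem_parabolic _ (by simp [Dd]), ?_⟩
      have hu₀ := coe_eq_finiteHom hθ (parabolic_mono _ (J_subset_D₀ i) hu.1)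
      have huinv : u.1 (P.root i, 0) = (P.root θ, 0) := by
        rw [← longest_apply_highest hθ hd hu]
        exact h.apply_apply_of_isLongest hu _
      rw [hu₀, finiteHom_apply, smul_root, Prod.mk.injEq] at huinv
      rw [hu₀, finiteHom_conj_affineReflection, P.root.injective huinv.1]
      change simpleReflection b θ none = _
      rw [simpleReflection_none, affineReflection_reflectionPerm_self]
      simp
    -- For `i ≠ d` the translation commutes with `s_i`, and conjugation by `u` stays in `W_J`.
    · refine ⟨u * gen b θ (some i) * u⁻¹, parabolic_mono _ (J_subset_Dd d)
        (mul_mem (mul_mem hu.1 (mem_parabolic _ (some_mem_J hid))) (inv_mem hu.1)), ?_⟩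
      have : b.toWeightBasis.repr (P.root i) d = 0 := by simp [hid]
      rw [this, neg_zero]
      rfl
  | one => exact ⟨1, one_mem _, by simp⟩
  | mul x y _ _ hx hy =>
    obtain ⟨x', hx', hx''⟩ := hx
    obtain ⟨y', hy', hy''⟩ := hy
    refine ⟨x' * y', mul_mem hx' hy', ?_⟩
    rw [Subgroup.coe_mul, hx'', hy'', Subgroup.coe_mul]
    group
  | inv x _ hx =>
    obtain ⟨x', hx', hx''⟩ := hx
    refine ⟨x'⁻¹, inv_mem hx', ?_⟩
    rw [Subgroup.coe_inv, hx'', Subgroup.coe_inv]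
    group

/-- Conjugation by `w_J τ_{ϖ_d^∨}` maps the longest element of `W₀` to that of `W_{D_d}`. -/
lemma conj_longest_eq (hθ : IsHighestRoot b θ) {d : b.support} (hd : IsCominuscule b θ d)
    {w₀ wd u : affineWeylGroup b θ} (hw₀ : IsLongest (gen b θ) (D₀ b) w₀)
    (hwd : IsLongest (gen b θ) (Dd b d) wd) (hu : IsLongest (gen b θ) (J b d) u) :
    u.1 * translation P (fundamentalCoweight b d) * w₀.1 *
      (u.1 * translation P (fundamentalCoweight b d))⁻¹ = wd.1 := by
  have h := isGeometricRep hθ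
  obtain ⟨y, hy, hy'⟩ := conj_mem_parabolic hθ hd hu hw₀.1
  rw [← hy']
  refine congrArg Subtype.val (h.eq_of_isLongest hwd hy fun i hi ↦ ?_)
  set T := translation P (fundamentalCoweight b d)
  have huinv : u.1⁻¹ = u.1 := congrArg Subtype.val (h.inv_eq_self_of_isLongest hu)
  have huu : ∀ v, u.1 (u.1 v) = v := h.apply_apply_of_isLongest hu
  have huneg : ∀ j ∈ J b d, -u.1 (affineBasis b θ j) ∈ cone (affineBasis b θ) (J b d) :=
    fun j hj ↦ h.neg_apply_mem_of_isLongest hu hj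
  have huθ := longest_apply_highest hθ hd hu
  have hud : u.1 (P.root d, 0) = (P.root θ, 0) := by rw [← huθ, huu]
  have hδ : u.1 (0, 1) = (0, 1) := by
    rw [coe_eq_finiteHom hθ (parabolic_mono _ (J_subset_D₀ d) hu.1)]
    simp
  -- `u * T` sends `α_d` to `-α₀` and acts on the roots of `J` as `u`.
  have hforward : ∀ j ∈ D₀ b, -(u.1 * T).toLinearMap (affineBasis b θ j) ∈
      cone (affineBasis b θ) (Dd b d) := by
    rintro (- | j) hj
    · exact absurd rfl hj
    rw [LinearEquiv.coe_coe, LinearEquiv.mul_apply]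
    by_cases hjd : j = d
    · subst hjd
      have h₁ : T (affineBasis b θ (some j)) = (P.root j, 0) - (0, 1) := by
        rw [affineBasis_apply]
        simp [T, simpleRoot, toLinearMap_fundamentalCoweight]
      have h₂ : -u.1 (T (affineBasis b θ (some j))) = affineBasis b θ none := by
        rw [h₁, map_sub, hud, hδ, affineBasis_apply]
        simp [simpleRoot]
      rw [h₂]
      exact basis_mem_cone (by simp [Dd])
    · rw [translation_fundamentalCoweight_basis (some_mem_J hjd)]
      exact cone_mono (J_subset_Dd d) (huneg _ (some_mem_J hjd))
  have hT : ∀ j ∈ J b d, (T⁻¹).toLinearMap (affineBasis b θ j) ∈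
      cone (affineBasis b θ) (J b d) := by
    intro j hj
    rw [LinearEquiv.coe_coe]
    conv in affineBasis b θ j => rw [← translation_fundamentalCoweight_basis hj]
    rw [show T⁻¹ (T (affineBasis b θ j)) = affineBasis b θ j from T.symm_apply_apply _]
    exact basis_mem_cone hj
  have hbackward : -(u.1 * T)⁻¹ (affineBasis b θ i) ∈ cone (affineBasis b θ) (D₀ b) := by
    rw [mul_inv_rev, huinv, LinearEquiv.mul_apply]
    rcases i with - | i
    · have h₁ : u.1 (affineBasis b θ none) = T (-(P.root d, 0)) := by
        have : affineBasis b θ none = (0, 1) - (P.root θ, 0) := by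
          rw [affineBasis_apply]; simp [simpleRoot]
        rw [this, map_sub, huθ, hδ]
        simp [T, toLinearMap_fundamentalCoweight]
      have h₂ : -T⁻¹ (u.1 (affineBasis b θ none)) = affineBasis b θ (some d) := by
        rw [h₁, show T⁻¹ (T (-(P.root d, 0))) = -(P.root d, 0) from T.symm_apply_apply _,
          neg_neg, affineBasis_apply]
        rfl
      rw [h₂]
      exact basis_mem_cone (by simp [D₀])
    · have hid : some i ∈ J b d := some_mem_J fun hid ↦ hi (by rw [hid]; rfl)
      rw [← map_neg]
      exact cone_mono (J_subset_D₀ d) (map_mem_cone _ hT (huneg _ hid))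
  -- The three factors `(uT)⁻¹`, `w₀`, `uT` each reverse the sign, so their product does too.
  have h₁ := neg_map_mem_cone w₀.1.toLinearMap
    (fun j hj ↦ h.neg_apply_mem_of_isLongest hw₀ hj) hbackward
  have h₂ := neg_map_mem_cone _ hforward h₁
  rw [Subgroup.subtype_apply, hy', LinearEquiv.mul_apply, LinearEquiv.mul_apply _ w₀.1]
  simpa using h₂

end Cominuscule

end

end AffineWeyl

theorem mainTheorem9 {ι M N : Type*} [Finite ι] [AddCommGroup M] [Module ℝ M]
    [AddCommGroup N] [Module ℝ N] (P : RootPairing ι ℝ M N)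
    [P.IsRootSystem] [P.IsCrystallographic] [P.IsReduced] [P.IsIrreducible]
    (b : P.Base) (θ : ι) (hθ : IsHighestRoot b θ)
    (d : b.support) (hd : IsCominuscule b θ d)
    (w₀ wd wJ w₀J wdJ : affineWeylGroup b θ)
    (hw₀ : IsLongest (gen b θ) (D₀ b) w₀)
    (hwd : IsLongest (gen b θ) (Dd b d) wd)
    (hwJ : IsLongest (gen b θ) (J b d) wJ)
    (hw₀J : IsMinRep (gen b θ) (J b d) w₀ w₀J)
    (hwdJ : IsMinRep (gen b θ) (J b d) wd wdJ) :
    ∃ φ : affineWeylGroup b θ ≃* SemidirectWeyl P, IsStandardIso b θ φ ∧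
      ∃ q : P.corootSpan ℤ,
        (q : N) = coweightAction P (φ w₀).right (fundamentalCoweight b d) -
          fundamentalCoweight b d ∧
        φ.symm (latticeElt P q) = w₀ * wJ * wd * wJ ∧
        φ.symm (latticeElt P q) = w₀J * wdJ := by
  have h := isGeometricRep hθ
  have hw₀inv := h.inv_eq_self_of_isLongest hw₀
  have hwJinv := h.inv_eq_self_of_isLongest hwJ
  have hprod : (standardIso hθ).symm (latticeElt P
      ⟨_, coweightAction_fundamentalCoweight_sub_mem d (standardIso hθ w₀).right⟩) =
      w₀ * wJ * wd * wJ := by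
    refine Subtype.ext ?_
    rw [coe_standardIso_symm, semidirectHom_latticeElt, translation_coweightAction_sub,
      ← coe_eq_finiteHom hθ hw₀.1]
    have hconj := conj_longest_eq hθ hd hw₀ hwd hwJ
    have h₀ : w₀.1⁻¹ = w₀.1 := congrArg Subtype.val hw₀inv
    have hJ' : wJ.1⁻¹ = wJ.1 := congrArg Subtype.val hwJinv
    -- Replacing `w_d` by `w_J T w₀ T⁻¹ w_J` makes the factors `w_J` cancel in pairs, leaving the
    -- commutator.
    simp only [Subgroup.coe_mul, ← hconj, mul_inv_rev, hJ', h₀]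
    have hJJ : wJ.1 * wJ.1 = 1 := mul_eq_one_iff_inv_eq.mpr hJ'
    simp only [mul_assoc, hJJ, mul_one]
    simp only [← mul_assoc wJ.1 wJ.1, hJJ, one_mul]
  refine ⟨standardIso hθ, isStandardIso_standardIso hθ, _, rfl, hprod, hprod.trans ?_⟩
  rw [h.eq_mul_of_isMinRep (J_subset_D₀ d) hw₀ hwJ hw₀J,
    h.eq_mul_of_isMinRep (J_subset_Dd d) hwd hwJ hwdJ, mul_assoc (w₀ * wJ)]
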